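/- **Machine models.** All alphabets and state sets are finite, all tapes are two-way infinite, and all machines are deterministic. A *standard one-tape Turing machine* $M$ has an input alphabet contained in its set $\Gamma$ of non-blank tape symbols, a transition function that prescribes a new state, a symbol to be written and a head move in $\{-1,0,+1\}$, and distinct halting states $q_{acc},q_{rej}$. It starts with its input $w$ alone on the tape, scanning the first symbol of $w$. If it halts, its result is its verdict (accept or reject) together with its output, which is the maximal blank-free word starting at the scanned cell. The partial function computed by $M$ maps $w$ to this result, and is undefined at $w$ if $M$ does not halt on $w$. An *input-tape machine* $R$ has a read-only input tape, finitely many work tapes, an output tape, and states $B\cup S\cup\{q_{acc},q_{rej}\}$ (a disjoint union) with a possibly partial transition function. A step from a *sighted* state (in $S$) depends on the scanned input symbol and moves the input head one cell to the left or to the right. A step from a *blind* state (in $B$) neither depends on the input nor moves the input head. In both kinds of steps $R$ may read, write and move the head (by $-1$, $0$ or $+1$ cells) on the work tapes and the output tape. There are no steps from $q_{acc}$ and $q_{rej}$. $R$ starts with empty work and output tapes and with the input head on the blank cell just to the left of the input. If it halts in $q_{acc}$ or $q_{rej}$, its result is the verdict together with the maximal blank-free word starting at the scanned cell of the output tape.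 The *dynamic part* of a configuration of $R$ is everything except the input string: the state, the contents and head positions of the work and output tapes, and the position of the input head. $R$ *scans its input in only two passes* if on every input its input head, once it has moved left, never again moves right; that is, it makes at most one left-to-right pass followed by at most one right-to-left pass, so that each input cell is read at most twice. $R$ has *zero thermodynamic cost* if 1. it is reversible: no configuration of $R$ (reachable or not) has more than one predecessor; and 2. it leaves no garbage: whenever a computation of $R$ on an input stops, the dynamic part contains nothing but the result. That is, the state is $q_{acc}$ or $q_{rej}$, all work tapes are blank, the output tape contains exactly a (possibly empty) output word starting in the initial cell of its head, and all heads (including the input head) are at their initial positions. **Theorem 1.** For every standard one-tape Turing machine $M$ there is a deterministic input-tape machine $M_{RT}$ that computes the same partial function as $M$ (it halts on the same inputs, with the same verdict and the same output), scans its input in only two passes, and has zero thermodynamic cost. Likewise, there is such a two-pass machine with zero thermodynamic cost that decides as $M$ does: it halts on the same inputs, with the same verdict and with an empty output tape. -/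

import Mathlib

universe u

namespace ReadTwice

/-! ### Tapes -/

/-- A two-way infinite tape over the non-blank symbols `α` (`none` is the blank symbol), together
with the absolute position of its head. -/
@[ext]
structure Tape (α : Type u) where
  cells : ℤ → Option α
  head : ℤ

namespace Tape

variable {α : Type u}

/-- The word `l` in the cells `0, …, l.length - 1`, all other cells blank, head on cell `0`. -/
def ofWord (l : List α) : Tape α where
  cells z := if 0 ≤ z then l[z.toNat]? else none
  head := 0

/-- The empty tape with its head on cell `0`. -/
def blank : Tape α where
  cells _ := none
  head := 0

/-- The scanned symbol. -/
def read (t : Tape α) : Option α := t.cells t.head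

/-- Write `s` on the scanned cell, then move the head by `d ∈ {-1, 0, 1}`. -/
def act (t : Tape α) (s : Option α) (d : SignType) : Tape α where
  cells := Function.update t.cells t.head s
  head := t.head + (d : ℤ)

/-- `y` is the maximal blank-free word that starts on the scanned cell and extends to the right. -/
def HasWord (t : Tape α) (y : List α) : Prop :=
  ∀ i : ℕ, i ≤ y.length → t.cells (t.head + (i : ℤ)) = y[i]?

end Tape

/-! ### Standard one-tape Turing machines -/

/-- A standard deterministic one-tape Turing machine with state set `Q`, input alphabet `A`
and non-blank tape symbols `Γ`, among which are the input symbols. -/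
structure OneTapeTM (A Γ Q : Type u) where
  embed : A ↪ Γ
  start : Q
  acc : Q
  rej : Q
  acc_ne_rej : acc ≠ rej
  /-- The transition function; its values at `acc` and `rej` are not used. -/
  δ : Q → Option Γ → Q × Option Γ × SignType

namespace OneTapeTM

variable {A Γ Q : Type u} (M : OneTapeTM A Γ Q)

/-- The halting state with verdict `v`. -/
def haltState (v : Bool) : Q := if v then M.acc else M.rej

open Classical in
/-- One step; there is none from the two halting states. -/
noncomputable def step (c : Q × Tape Γ) : Option (Q × Tape Γ) :=
  if c.1 = M.acc ∨ c.1 = M.rej then none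
  else
    let r := M.δ c.1 c.2.read
    some (r.1, c.2.act r.2.1 r.2.2)

/-- The initial configuration: the input alone on the tape, the head on its first symbol. -/
def init (w : List A) : Q × Tape Γ := (M.start, Tape.ofWord (w.map M.embed))

/-- On input `w` the machine halts with verdict `v`. -/
def HaltsWith (w : List A) (v : Bool) : Prop :=
  ∃ t : Tape Γ, StateTransition.Reaches M.step (M.init w) (M.haltState v, t)

/-- On input `w` the machine halts with verdict `v` and output word `y`. -/
def Yields (w : List A) (v : Bool) (y : List Γ) : Prop :=
  ∃ t : Tape Γ, StateTransition.Reaches M.step (M.init w) (M.haltState v, t) ∧ t.HasWord y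

end OneTapeTM

/-! ### Machines with a read-only input tape, work tapes and an output tape -/

/-- The states: blind states, sighted states, the accept state and the reject state. -/
inductive State (B S : Type u) : Type u
  | blind (b : B)
  | sighted (s : S)
  | acc
  | rej

/-- What a transition does apart from moving the input head: the next state, and for each work tape
and for the output tape the symbol to be written and the head move. -/
structure Action (B S Φ Γ : Type u) (k : ℕ) where
  next : State B S
  work : Fin k → Option Φ × SignType
  out : Option Γ × SignType

/-- A deterministic Turing machine with a read-only input tape over `A`, finitely many work tapes
and an output tape over `Γ`. A transition from a sighted state depends on the scanned input symbol
and always moves the input head by one cell; a transition from a blind state neither depends on the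
input nor moves the input head. The transition functions may be partial. -/
structure InputTM (A Γ : Type u) where
  /-- blind states -/
  B : Type u
  /-- sighted states -/
  S : Type u
  /-- non-blank work tape symbols -/
  Φ : Type u
  finite_B : Finite B
  finite_S : Finite S
  finite_Φ : Finite Φ
  /-- number of work tapes -/
  k : ℕ
  start : State B S
  δSighted : S → Option A → (Fin k → Option Φ) → Option Γ →
    Option (Turing.Dir × Action B S Φ Γ k)
  δBlind : B → (Fin k → Option Φ) → Option Γ → Option (Action B S Φ Γ k)

namespace InputTM

variable {A Γ : Type u} (R : InputTM A Γ)

/-- The dynamic part of a configuration, that is, everything except the (never changing) input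
string: the state, the input head position, and the work and output tapes with their heads. -/
@[ext]
structure Dyn where
  state : State R.B R.S
  inHead : ℤ
  work : Fin R.k → Tape R.Φ
  out : Tape Γ

variable {R} in
/-- Carry out an action and move the input head by `d`. -/
def Dyn.apply (c : R.Dyn) (d : ℤ) (a : Action R.B R.S R.Φ Γ R.k) : R.Dyn where
  state := a.next
  inHead := c.inHead + d
  work i := (c.work i).act (a.work i).1 (a.work i).2
  out := c.out.act a.out.1 a.out.2

/-- One step on the input string `w`, which occupies the cells `0, …, w.length - 1` of the input
tape, with blanks on both sides. -/
def step (w : List A) (c : R.Dyn) : Option R.Dyn :=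
  match c.state with
  | .blind b =>
      (R.δBlind b (fun i => (c.work i).read) c.out.read).map fun a => c.apply 0 a
  | .sighted s =>
      (R.δSighted s ((Tape.ofWord w).cells c.inHead) (fun i => (c.work i).read) c.out.read).map
        fun r => c.apply (match r.1 with
          | .left => -1
          | .right => 1) r.2
  | .acc => none
  | .rej => none

/-- The initial dynamic part: all work tapes and the output tape are empty, and the input head is
on the blank cell immediately to the left of the input string. -/
def init : R.Dyn where
  state := R.start
  inHead := -1
  work _ := Tape.blank
  out := Tape.blank

/-- The halting state with verdict `v`. -/
def haltState (v : Bool) : State R.B R.S := if v then .acc else .rej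

/-- On input `w` the machine halts with verdict `v` and output word `y`. -/
def Yields (w : List A) (v : Bool) (y : List Γ) : Prop :=
  ∃ c : R.Dyn, StateTransition.Reaches (R.step w) R.init c ∧ c.state = R.haltState v ∧ c.out.HasWord y

/-- The input is scanned in at most two passes, the first from left to right and the second from
right to left: once the input head has moved to the left, it never moves to the right again. -/
def TwoPass : Prop :=
  ∀ (w : List A) (c c' d d' : R.Dyn),
    StateTransition.Reaches (R.step w) R.init c → R.step w c = some c' → c'.inHead < c.inHead →
    StateTransition.Reaches (R.step w) c' d → R.step w d = some d' → d'.inHead ≤ d.inHead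

/-- No configuration has more than one predecessor. -/
def Reversible : Prop :=
  ∀ (w : List A) (c₁ c₂ c : R.Dyn),
    R.step w c₁ = some c → R.step w c₂ = some c → c₁ = c₂

/-- The dynamic part that contains nothing but the verdict `v` and the output `y`: all work tapes
are empty and all heads are at their initial positions. -/
def final (v : Bool) (y : List Γ) : R.Dyn where
  state := R.haltState v
  inHead := -1
  work _ := Tape.blank
  out := Tape.ofWord y

/-- Whenever a computation stops, only its result is left: there is no garbage. -/
def GarbageFree : Prop :=
  ∀ (w : List A) (c : R.Dyn), StateTransition.Reaches (R.step w) R.init c → R.step w c = none →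
    ∃ (v : Bool) (y : List Γ), c = R.final v y

/-- Zero thermodynamic cost: no step forgets information, and nothing has to be erased at the
end. -/
def ZeroThermodynamicCost : Prop := R.Reversible ∧ R.GarbageFree

/-- `R` computes the same partial function as `M`: it halts on the same inputs, with the same
verdict and the same output word. -/
def ComputesSame {Q : Type u} (M : OneTapeTM A Γ Q) : Prop :=
  ∀ (w : List A) (v : Bool) (y : List Γ), R.Yields w v y ↔ M.Yields w v y

/-- `R` decides as `M` does: it halts on the same inputs, with the same verdict and with nothing on
the output tape. -/
def DecidesSame {Q : Type u} (M : OneTapeTM A Γ Q) : Prop :=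
  ∀ (w : List A) (v : Bool) (y : List Γ), R.Yields w v y ↔ y = [] ∧ M.HaltsWith w v

end InputTM

end ReadTwice

/-! The construction is Bennett's: compute while recording a history, copy the result, then
uncompute. The first pass copies the input to a work tape. `M` then runs on that copy, every step
pushing the old control state and the overwritten symbol onto a history tape. The output is copied
to the output tape, and running backwards consumes the history and restores the copy of the input.
What remains is the copy itself. Erasing it alone would lose information, but erasing it symbol by
symbol against the input loses none, and this is the second pass. The return to the beginning of the
copy is itself part of the recorded process, so uncomputing leaves the work head at the right end,
where a right-to-left erasure has to start.

Reversibility must hold at all configurations, reachable or not. It is reduced to a local condition: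
all head moves are functions of the state entered, and a function `prev` recovers the old state and
scanned symbols from the new state, the symbols written and the input symbol (`Program.reversible`).
The absence of garbage combines `reach_final`, determinism, and `step_ne_none_of_not_halting`. -/

namespace ReadTwice

/-! ### Tape actions and their inverses -/

namespace Tape

variable {α β : Type u}

/-- Rename the symbols of a tape. -/
def map (f : α → β) (t : Tape α) : Tape β where
  cells z := (t.cells z).map f
  head := t.head

/-- Move the head by `d` cells. -/
def shift (t : Tape α) (d : ℤ) : Tape α where
  cells := t.cells
  head := t.head + d

theorem read_map (f : α → β) (t : Tape α) : (t.map f).read = t.read.map f := rfl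

theorem act_map (f : α → β) (t : Tape α) (s : Option α) (d : SignType) :
    (t.map f).act (s.map f) d = (t.act s d).map f := by
  ext1
  · funext z
    by_cases h : z = t.head <;> simp [act, map, Function.update_apply, h]
  · rfl

theorem act_read (t : Tape α) (d : SignType) : t.act t.read d = t.shift d := by
  simp [act, shift, read]

theorem read_act_shift (t : Tape α) (s : Option α) (d : SignType) :
    ((t.act s d).shift (-d : SignType)).read = s := by
  simp [act, shift, read, SignType.coe_neg]

theorem act_shift_act (t : Tape α) (s : Option α) (d e : SignType) :
    ((t.act s d).shift (-d : SignType)).act t.read e = t.shift e := by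
  simp [act, shift, read, SignType.coe_neg]

/-- A tape is determined by the outcome of an action, the move, and the symbol read. -/
theorem act_injective {t t' : Tape α} {s s' : Option α} {d : SignType}
    (h : t.act s d = t'.act s' d) (hr : t.read = t'.read) : t = t' := by
  have h1 : t.head = t'.head := by simpa [act] using congrArg Tape.head h
  have h2 := congrArg Tape.cells h
  simp only [act] at h2
  ext1
  · funext z
    by_cases hz : z = t.head
    · subst hz
      simpa [read, h1] using hr
    · have := congrFun h2 z
      rwa [Function.update_of_ne hz, Function.update_of_ne (h1 ▸ hz)] at this
  · exact h1

theorem act_written {t t' : Tape α} {s s' : Option α} {d : SignType}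
    (h : t.act s d = t'.act s' d) : s = s' := by
  have h1 : t.head = t'.head := by simpa [act] using congrArg Tape.head h
  have h2 := congrFun (congrArg Tape.cells h) t.head
  simp only [act, Function.update_self] at h2
  rw [h2, h1, Function.update_self]

end Tape

/-! ### Programs with locally invertible rules -/

/-- A program for an input-tape machine with one work tape over `Γ` and one work tape over `Λ`.
A rule prescribes the next state and the symbols to be written; the head moves that follow depend
on the next state only. The function `prev` undoes the rules. -/
structure Program (A Γ : Type u) where
  B : Type u
  S : Type u
  Λ : Type u
  finite_B : Finite B
  finite_S : Finite S
  finite_Λ : Finite Λ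
  start : State B S
  blindRule : B → Option Γ × Option Λ × Option Γ →
    Option (State B S × Option Γ × Option Λ × Option Γ)
  sightedRule : S → Option A → Option Γ × Option Λ × Option Γ →
    Option (State B S × Option Γ × Option Λ × Option Γ)
  /-- the input head move by which a state is entered, `none` if it is entered blindly -/
  entry : State B S → Option Turing.Dir
  move : State B S → SignType × SignType × SignType
  prev : State B S → Option A → Option Γ × Option Λ × Option Γ →
    State B S × Option Γ × Option Λ × Option Γ
  prev_blind : ∀ b a x q y, blindRule b x = some (q, y) → prev q a y = (.blind b, x)
  prev_sighted : ∀ s a x q y, sightedRule s a x = some (q, y) → prev q a y = (.sighted s, x)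

/-- Read a symbol of a disjoint union as a symbol of the left part. -/
def readLeft {α β : Type u} : Option (α ⊕ β) → Option (Option α)
  | none => some none
  | some (.inl a) => some (some a)
  | some (.inr _) => none

/-- Read a symbol of a disjoint union as a symbol of the right part. -/
def readRight {α β : Type u} : Option (α ⊕ β) → Option (Option β)
  | none => some none
  | some (.inl _) => none
  | some (.inr b) => some (some b)

theorem readLeft_map {α β : Type u} (x : Option α) :
    readLeft (x.map (Sum.inl : α → α ⊕ β)) = some x := by
  cases x <;> rfl

theorem readRight_map {α β : Type u} (x : Option β) :
    readRight (x.map (Sum.inr : β → α ⊕ β)) = some x := by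
  cases x <;> rfl

theorem eq_of_readLeft {α β : Type u} {x : Option (α ⊕ β)} {y : Option α}
    (h : readLeft x = some y) : x = y.map Sum.inl := by
  rcases x with _ | _ | _ <;> simp [readLeft] at h <;> subst h <;> rfl

theorem eq_of_readRight {α β : Type u} {x : Option (α ⊕ β)} {y : Option β}
    (h : readRight x = some y) : x = y.map Sum.inr := by
  rcases x with _ | _ | _ <;> simp [readRight] at h <;> subst h <;> rfl

/-- The displacement of the input head that belongs to an entry. -/
def entryMove : Option Turing.Dir → ℤ
  | none => 0
  | some .left => -1
  | some .right => 1

namespace Program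

variable {A Γ : Type u} (P : Program A Γ)

/-- The action that enters `q` and writes `y`. -/
def action (q : State P.B P.S) (y : Option Γ × Option P.Λ × Option Γ) :
    Action P.B P.S (Γ ⊕ P.Λ) Γ 2 where
  next := q
  work := ![(y.1.map .inl, (P.move q).1), (y.2.1.map .inr, (P.move q).2.1)]
  out := (y.2.2, (P.move q).2.2)

/-- The symbols scanned on the two work tapes and the output tape, if they are well-typed. -/
def scanned (f : Fin 2 → Option (Γ ⊕ P.Λ)) (o : Option Γ) :
    Option (Option Γ × Option P.Λ × Option Γ) :=
  (readLeft (f 0)).bind fun t => (readRight (f 1)).map fun h => (t, h, o)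

theorem scanned_eq_some {f : Fin 2 → Option (Γ ⊕ P.Λ)} {o : Option Γ}
    {x : Option Γ × Option P.Λ × Option Γ} (h : P.scanned f o = some x) :
    f 0 = x.1.map .inl ∧ f 1 = x.2.1.map .inr ∧ o = x.2.2 := by
  simp only [scanned, Option.bind_eq_some_iff, Option.map_eq_some_iff] at h
  obtain ⟨t, ht, l, hl, rfl⟩ := h
  exact ⟨eq_of_readLeft ht, eq_of_readRight hl, rfl⟩

variable [Finite Γ]

/-- The input-tape machine that executes a program. -/
abbrev toInputTM : InputTM A Γ where
  B := P.B
  S := P.S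
  Φ := Γ ⊕ P.Λ
  finite_B := P.finite_B
  finite_S := P.finite_S
  finite_Φ := by
    have := P.finite_Λ
    infer_instance
  k := 2
  start := P.start
  δSighted s a f o :=
    (P.scanned f o).bind fun x => (P.sightedRule s a x).bind fun r =>
      (P.entry r.1).map fun d => (d, P.action r.1 r.2)
  δBlind b f o :=
    (P.scanned f o).bind fun x => (P.blindRule b x).bind fun r =>
      -- A rule whose kind disagrees with `entry` is discarded, so the displacement of the input
      -- head can always be read off the state entered.
      if P.entry r.1 = none then some (P.action r.1 r.2) else none

/-- The configuration with the given state, input head position and tapes. -/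
def cfg (q : State P.B P.S) (i : ℤ) (t : Tape Γ) (h : Tape P.Λ) (o : Tape Γ) :
    P.toInputTM.Dyn where
  state := q
  inHead := i
  work := ![t.map .inl, h.map .inr]
  out := o

theorem apply_action (q q' : State P.B P.S) (i e : ℤ) (t : Tape Γ) (h : Tape P.Λ) (o : Tape Γ)
    (y : Option Γ × Option P.Λ × Option Γ) :
    InputTM.Dyn.apply (P.cfg q i t h o) e (P.action q' y) =
      P.cfg q' (i + e) (t.act y.1 (P.move q').1) (h.act y.2.1 (P.move q').2.1)
        (o.act y.2.2 (P.move q').2.2) := by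
  ext1
  · rfl
  · rfl
  · funext j
    fin_cases j
    · exact Tape.act_map _ _ _ _
    · exact Tape.act_map _ _ _ _
  · rfl

theorem scanned_cfg (q : State P.B P.S) (i : ℤ) (t : Tape Γ) (h : Tape P.Λ) (o : Tape Γ) :
    P.scanned (fun j => ((P.cfg q i t h o).work j).read) (P.cfg q i t h o).out.read =
      some (t.read, h.read, o.read) := by
  simp [scanned, cfg, Tape.read_map, readLeft_map, readRight_map]

theorem step_blind {b : P.B} {q : State P.B P.S} {y : Option Γ × Option P.Λ × Option Γ}
    {t : Tape Γ} {h : Tape P.Λ} {o : Tape Γ} (w : List A) (i : ℤ)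
    (hr : P.blindRule b (t.read, h.read, o.read) = some (q, y)) (he : P.entry q = none) :
    P.toInputTM.step w (P.cfg (.blind b) i t h o) =
      some (P.cfg q i (t.act y.1 (P.move q).1) (h.act y.2.1 (P.move q).2.1)
        (o.act y.2.2 (P.move q).2.2)) := by
  have h0 := P.scanned_cfg (.blind b) i t h o
  have h1 := P.apply_action (.blind b) q i 0 t h o y
  rw [add_zero] at h1
  rw [← h1]
  change Option.map _ (Option.bind (P.scanned _ _) _) = _
  rw [h0]
  simp [hr, he]

theorem step_sighted {s : P.S} {q : State P.B P.S} {y : Option Γ × Option P.Λ × Option Γ}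
    {t : Tape Γ} {h : Tape P.Λ} {o : Tape Γ} {w : List A} {i : ℤ} {d : Turing.Dir}
    (hr : P.sightedRule s ((Tape.ofWord w).cells i) (t.read, h.read, o.read) = some (q, y))
    (he : P.entry q = some d) :
    P.toInputTM.step w (P.cfg (.sighted s) i t h o) =
      some (P.cfg q (i + entryMove (some d)) (t.act y.1 (P.move q).1) (h.act y.2.1 (P.move q).2.1)
        (o.act y.2.2 (P.move q).2.2)) := by
  have h0 := P.scanned_cfg (.sighted s) i t h o
  have h1 := P.apply_action (.sighted s) q i (entryMove (some d)) t h o y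
  rw [← h1]
  change Option.map _ (Option.bind (P.scanned _ _) _) = _
  rw [h0]
  have hr' : P.sightedRule s ((Tape.ofWord w).cells (P.cfg (.sighted s) i t h o).inHead)
    (t.read, h.read, o.read) = some (q, y) := hr
  simp only [Option.bind_some, hr', he, Option.map_some]
  cases d <;> rfl

/-- Every step executes a rule. -/
theorem exists_rule_of_step {w : List A} {c c' : P.toInputTM.Dyn}
    (h : P.toInputTM.step w c = some c') :
    ∃ x y, ((∃ b, c.state = .blind b ∧ P.blindRule b x = some (c'.state, y) ∧
          P.entry c'.state = none) ∨
        (∃ s, c.state = .sighted s ∧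
          P.sightedRule s ((Tape.ofWord w).cells c.inHead) x = some (c'.state, y) ∧
          P.entry c'.state ≠ none)) ∧
      ((c.work 0).read = x.1.map .inl ∧ (c.work 1).read = x.2.1.map .inr ∧ c.out.read = x.2.2) ∧
      c' = c.apply (entryMove (P.entry c'.state)) (P.action c'.state y) := by
  unfold InputTM.step at h
  split at h
  · next b hb =>
    simp only [Option.map_eq_some_iff, Option.bind_eq_some_iff] at h
    obtain ⟨a, ⟨x, hx, r, hr, ha⟩, rfl⟩ := h
    split_ifs at ha with he
    cases ha
    refine ⟨x, r.2, Or.inl ⟨b, hb, hr, he⟩, P.scanned_eq_some hx, ?_⟩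
    change _ = c.apply (entryMove (P.entry r.1)) _
    rw [he]
    rfl
  · next s hs =>
    simp only [Option.map_eq_some_iff, Option.bind_eq_some_iff] at h
    obtain ⟨a, ⟨x, hx, r, hr, d, hd, rfl⟩, rfl⟩ := h
    refine ⟨x, r.2, Or.inr ⟨s, hs, hr, ?_⟩, P.scanned_eq_some hx, ?_⟩
    · change P.entry r.1 ≠ none
      simp [hd]
    · change _ = c.apply (entryMove (P.entry r.1)) _
      rw [hd]
      cases d <;> rfl
  · cases h
  · cases h

theorem inHead_of_step {w : List A} {c c' : P.toInputTM.Dyn}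
    (h : P.toInputTM.step w c = some c') :
    c'.inHead = c.inHead + entryMove (P.entry c'.state) := by
  obtain ⟨x, y, -, -, h⟩ := P.exists_rule_of_step h
  exact congrArg InputTM.Dyn.inHead h

/-- The state entered fixes all head moves, hence all previous head positions. The written symbols
can then be read off the tapes, and `prev` yields the old state and the old scanned symbols. No
other cell has changed. -/
theorem reversible : P.toInputTM.Reversible := by
  intro w c₁ c₂ c h₁ h₂
  have e₁ := P.inHead_of_step h₁
  have e₂ := P.inHead_of_step h₂
  have e : c₁.inHead = c₂.inHead := by omega
  obtain ⟨x₁, y₁, r₁, ⟨a₁, b₁, o₁⟩, k₁⟩ := P.exists_rule_of_step h₁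
  obtain ⟨x₂, y₂, r₂, ⟨a₂, b₂, o₂⟩, k₂⟩ := P.exists_rule_of_step h₂
  have k := k₁.symm.trans k₂
  have w0 := congrFun (congrArg InputTM.Dyn.work k) 0
  have w1 := congrFun (congrArg InputTM.Dyn.work k) 1
  have wo := congrArg InputTM.Dyn.out k
  have hy : y₁ = y₂ := by
    have q0 := Option.map_injective Sum.inl_injective (Tape.act_written w0)
    have q1 := Option.map_injective Sum.inr_injective (Tape.act_written w1)
    exact Prod.ext q0 (Prod.ext q1 (Tape.act_written wo))
  subst hy
  -- `prev` receives the input symbol at the position before the move, which is common to both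
  -- predecessors by `e`.
  have p₁ : P.prev c.state ((Tape.ofWord w).cells c₁.inHead) y₁ = (c₁.state, x₁) := by
    rcases r₁ with ⟨b, hb, hr, -⟩ | ⟨b, hb, hr, -⟩ <;> rw [hb]
    · exact P.prev_blind _ _ _ _ _ hr
    · exact P.prev_sighted _ _ _ _ _ hr
  have p₂ : P.prev c.state ((Tape.ofWord w).cells c₁.inHead) y₁ = (c₂.state, x₂) := by
    rw [e]
    rcases r₂ with ⟨b, hb, hr, -⟩ | ⟨b, hb, hr, -⟩ <;> rw [hb]
    · exact P.prev_blind _ _ _ _ _ hr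
    · exact P.prev_sighted _ _ _ _ _ hr
  obtain ⟨hs, rfl⟩ := Prod.ext_iff.1 (p₁.symm.trans p₂)
  ext1
  · exact hs
  · exact e
  · funext j
    fin_cases j
    · exact Tape.act_injective w0 (a₁.trans a₂.symm)
    · exact Tape.act_injective w1 (b₁.trans b₂.symm)
  · exact Tape.act_injective wo (o₁.trans o₂.symm)

end Program

/-! ### The compute-copy-uncompute machine: rules and inverse rules -/

/-- A deterministic process with control states `Y` on one tape over `Γ`. The head moves by
`move y` when control enters `y`, and the process stops where `verdict` is defined. The map `emit`
translates the tape content into the output. -/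
structure Simulation (A Γ Y : Type u) where
  embed : A ↪ Γ
  entrance : Y
  move : Y → SignType
  verdict : Y → Option Bool
  next : Y → Option Γ → Y × Option Γ
  emit : Option Γ → Option Γ

/-- Blind states of the reversible two-pass machine: start, end of the first pass, simulation,
copying of the output (four states), backward simulation, and erasing of the copied input. -/
inductive BlindState (Y : Type u) : Type u
  | start
  | enter
  | sim (y : Y)
  | halted (y : Y)
  | copy (y : Y)
  | rewind (y : Y)
  | copied (y : Y)
  | back (v : Bool) (y : Y)
  | erase (v : Bool)

/-- Sighted states of the reversible two-pass machine. -/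
inductive SightedState : Type u
  | first
  | load
  | turn (v : Bool)
  | second (v : Bool)
  | unload (v : Bool)

instance {Y : Type u} [Finite Y] : Finite (BlindState Y) := by
  let f : BlindState Y → Option (Fin 6 × Bool × Option Y) := fun
    | .start => none
    | .enter => some (0, false, none)
    | .sim y => some (1, false, some y)
    | .halted y => some (2, false, some y)
    | .copy y => some (3, false, some y)
    | .rewind y => some (4, false, some y)
    | .copied y => some (5, false, some y)
    | .back v y => some (0, v, some y)
    | .erase v => some (1, v, none)
  refine Finite.of_injective f fun a b h => ?_
  cases a <;> cases b <;> simp_all [f]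

instance : Finite SightedState.{u} := by
  let f : SightedState.{u} → Fin 4 × Bool := fun
    | .first => (0, false)
    | .load => (0, true)
    | .turn v => (1, v)
    | .second v => (2, v)
    | .unload v => (3, v)
  refine Finite.of_injective f fun a b h => ?_
  cases a <;> cases b <;> simp_all [f]

namespace Simulation

variable {A Γ Y : Type u} (C : Simulation A Γ Y)

open BlindState SightedState Classical

/-- The blind rules of the reversible two-pass machine. Each forward step is recorded on the history
tape, whose first symbol is the marker `none`. -/
noncomputable def blindRule : BlindState Y →
    Option Γ × Option (Option (Y × Option Γ)) × Option Γ →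
    Option (State (BlindState Y) SightedState.{u} × Option Γ × Option (Option (Y × Option Γ)) ×
      Option Γ)
  | start, x => some (.sighted first, x)
  | enter, (t, none, o) => some (.blind (sim C.entrance), t, some none, o)
  | enter, _ => none
  | sim y, (t, h, o) =>
    match C.verdict y, h, o with
    | none, none, o => some (.blind (sim (C.next y t).1), (C.next y t).2, some (some (y, t)), o)
    | some _, h, none => some (.blind (halted y), t, h, none)
    | _, _, _ => none
  | halted y, (t, h, none) => some (.blind (copy y), t, h, none)
  | halted _, _ => none
  | copy y, (t, h, none) =>
    match C.emit t with
    | some a => some (.blind (copy y), t, h, some a)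
    | none => some (.blind (rewind y), t, h, none)
  | copy _, _ => none
  | rewind y, (t, h, some a) => some (.blind (rewind y), t, h, some a)
  | rewind y, (t, h, none) => some (.blind (copied y), t, h, none)
  | copied y, x => (C.verdict y).map fun v => (.blind (back v y), x)
  -- The record is checked against the present state and symbol. In an unreachable configuration it
  -- could be false, and popping it would then merge configurations.
  | back v y, (t, some (some (z, s)), o) =>
    if C.verdict z = none ∧ C.next z s = (y, t) then some (.blind (back v z), s, none, o) else none
  | back v y, (t, some none, o) =>
    if y = C.entrance then some (.sighted (turn v), t, none, o) else none
  | back _ _, (_, none, _) => none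
  | erase v, (some a, h, o) => some (.sighted (unload v), some a, h, o)
  | erase v, (none, h, o) => some (if v then .acc else .rej, none, h, o)

/-- The sighted rules of the reversible two-pass machine. -/
noncomputable def sightedRule : SightedState.{u} → Option A →
    Option Γ × Option (Option (Y × Option Γ)) × Option Γ →
    Option (State (BlindState Y) SightedState.{u} × Option Γ × Option (Option (Y × Option Γ)) ×
      Option Γ)
  | first, none, x => some (.sighted load, x)
  | load, some a, (none, h, o) => some (.sighted load, some (C.embed a), h, o)
  | load, none, x => some (.blind enter, x)
  | turn v, none, x => some (.sighted (second v), x)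
  | second v, none, x => some (.blind (erase v), x)
  | unload v, some a, (t, h, o) =>
    if t = some (C.embed a) then some (.blind (erase v), none, h, o) else none
  | _, _, _ => none

/-- The input head move by which a state is entered. -/
def entry : State (BlindState Y) SightedState.{u} → Option Turing.Dir
  | .sighted load => some .right
  | .blind enter => some .right
  | .sighted (second _) => some .left
  | .blind (erase _) => some .left
  | _ => none

/-- The head moves on the simulation tape, the history tape and the output tape by which a state is
entered. -/
def moves : State (BlindState Y) SightedState.{u} → SignType × SignType × SignType
  -- Every entry to `load` moves right, also the one from `first`; this move compensates in advance.
  -- The moves for `halted` and `copied` play the same role around the loops of `copy` and `rewind`,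
  -- and those for `acc` and `rej` bring the head back from cell `-1` after erasing.
  | .sighted first => (-1, 0, 0)
  | .sighted load => (1, 0, 0)
  | .blind (sim y) => (C.move y, 1, 0)
  | .blind (halted _) => (-1, 0, -1)
  | .blind (copy _) => (1, 0, 1)
  | .blind (rewind _) => (-1, 0, -1)
  | .blind (copied _) => (1, 0, 1)
  | .blind (back _ y) => (-C.move y, -1, 0)
  | .blind (erase _) => (-1, 0, 0)
  | .acc => (1, 0, 0)
  | .rej => (1, 0, 0)
  | _ => (0, 0, 0)

/-- The inverse of the rules. -/
noncomputable def prev : State (BlindState Y) SightedState.{u} → Option A →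
    Option Γ × Option (Option (Y × Option Γ)) × Option Γ →
    State (BlindState Y) SightedState.{u} × Option Γ × Option (Option (Y × Option Γ)) × Option Γ
  | .sighted first, _, x => (.blind start, x)
  | .sighted load, none, x => (.sighted first, x)
  | .sighted load, some _, (_, h, o) => (.sighted load, none, h, o)
  | .blind enter, _, x => (.sighted load, x)
  | .blind (sim _), _, (_, some (some (z, s)), o) => (.blind (sim z), s, none, o)
  | .blind (sim _), _, (t, _, o) => (.blind enter, t, none, o)
  | .blind (halted y), _, x => (.blind (sim y), x)
  | .blind (copy y), _, (t, h, none) => (.blind (halted y), t, h, none)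
  | .blind (copy y), _, (t, h, some _) => (.blind (copy y), t, h, none)
  | .blind (rewind y), _, (t, h, none) => (.blind (copy y), t, h, none)
  | .blind (rewind y), _, (t, h, some a) => (.blind (rewind y), t, h, some a)
  | .blind (copied y), _, x => (.blind (rewind y), x)
  | .blind (back v z), _, (s, h, o) =>
    if C.verdict z = none then
      (.blind (back v (C.next z s).1), (C.next z s).2, some (some (z, s)), o)
    else (.blind (copied z), s, h, o)
  | .sighted (turn v), _, (t, _, o) => (.blind (back v C.entrance), t, some none, o)
  | .sighted (second v), _, x => (.sighted (turn v), x)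
  | .blind (erase v), none, x => (.sighted (second v), x)
  | .blind (erase v), some a, (_, h, o) => (.sighted (unload v), some (C.embed a), h, o)
  | .sighted (unload v), _, x => (.blind (erase v), x)
  | .acc, _, x => (.blind (erase true), x)
  | .rej, _, x => (.blind (erase false), x)
  -- A dummy value: no rule enters `start`.
  | .blind start, _, x => (.blind start, x)

/-- Where two rules enter the same state, something visible separates them: for `sim`, a record or
the marker just written on the history tape; for `copy` and `rewind`, whether the output symbol is
blank; for `back v z`, whether `z` has a verdict. -/
theorem prev_blindRule (b : BlindState Y) (a : Option A)
    (x : Option Γ × Option (Option (Y × Option Γ)) × Option Γ)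
    (q : State (BlindState Y) SightedState.{u})
    (y : Option Γ × Option (Option (Y × Option Γ)) × Option Γ)
    (h : C.blindRule b x = some (q, y)) : C.prev q a y = (.blind b, x) := by
  unfold blindRule at h
  split at h
  case h_4 z t l o =>
    split at h <;> cases h <;> rfl
  case h_7 z t l =>
    split at h <;> cases h <;> rfl
  case h_11 z x =>
    obtain ⟨v, hv, h⟩ := Option.map_eq_some_iff.1 h
    cases h
    simp [prev, hv]
  case h_12 v z t z' s o =>
    split_ifs at h with hc
    cases h
    simp [prev, hc.1, hc.2]
  case h_13 =>
    split_ifs at h with hc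
    cases h
    simp [prev, hc]
  case h_16 v _ _ =>
    cases v <;> cases h <;> rfl
  all_goals cases h
  all_goals rfl

/-- Here the input symbol separates the rules: `load` and `erase` are entered over a blank at the
start of a pass and over an input symbol inside the loop. -/
theorem prev_sightedRule (s : SightedState.{u}) (a : Option A)
    (x : Option Γ × Option (Option (Y × Option Γ)) × Option Γ)
    (q : State (BlindState Y) SightedState.{u})
    (y : Option Γ × Option (Option (Y × Option Γ)) × Option Γ)
    (h : C.sightedRule s a x = some (q, y)) : C.prev q a y = (.sighted s, x) := by
  unfold sightedRule at h
  split at h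
  case h_6 =>
    split_ifs at h with hc
    cases h
    simp [prev, hc]
  all_goals cases h
  all_goals rfl

/-- The reversible two-pass machine, as a program. -/
noncomputable abbrev program [Finite Γ] [Finite Y] : Program A Γ where
  B := BlindState Y
  S := SightedState.{u}
  Λ := Option (Y × Option Γ)
  finite_B := inferInstance
  finite_S := inferInstance
  finite_Λ := inferInstance
  start := .blind start
  blindRule := C.blindRule
  sightedRule := C.sightedRule
  entry := entry
  move := C.moves
  prev := C.prev
  prev_blind := C.prev_blindRule
  prev_sighted := C.prev_sightedRule

end Simulation

/-! ### The two-pass property -/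

namespace Simulation

variable {A Γ Y : Type u} (C : Simulation A Γ Y)

open BlindState SightedState StateTransition

/-- The states of the second pass. -/
def InSecondPass : State (BlindState Y) SightedState.{u} → Prop
  | .sighted (second _) => True
  | .blind (erase _) => True
  | .sighted (unload _) => True
  | .acc => True
  | .rej => True
  | _ => False

theorem inSecondPass_of_entry {q : State (BlindState Y) SightedState.{u}}
    (h : entry q = some .left) : InSecondPass q := by
  unfold entry at h
  split at h <;> cases h <;> trivial

theorem inSecondPass_of_blindRule {b : BlindState Y}
    {x y : Option Γ × Option (Option (Y × Option Γ)) × Option Γ}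
    {q : State (BlindState Y) SightedState.{u}} (hr : C.blindRule b x = some (q, y))
    (hb : InSecondPass (.blind b : State (BlindState Y) SightedState.{u})) : InSecondPass q := by
  cases b <;> try exact hb.elim
  next v =>
  obtain ⟨_ | a, l, o⟩ := x <;> cases v <;> cases hr <;> trivial

theorem inSecondPass_of_sightedRule {s : SightedState.{u}} {a : Option A}
    {x y : Option Γ × Option (Option (Y × Option Γ)) × Option Γ}
    {q : State (BlindState Y) SightedState.{u}} (hr : C.sightedRule s a x = some (q, y))
    (hs : InSecondPass (.sighted s : State (BlindState Y) SightedState.{u})) :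
    InSecondPass q := by
  unfold sightedRule at hr
  split at hr
  case h_6 =>
    split_ifs at hr
    cases hr
    trivial
  all_goals first | exact hs.elim | cases hr
  trivial

variable [Finite Γ] [Finite Y]

theorem inSecondPass_step {w : List A} {c c' : C.program.toInputTM.Dyn}
    (h : C.program.toInputTM.step w c = some c') (hc : InSecondPass c.state) :
    InSecondPass c'.state := by
  obtain ⟨x, y, ⟨b, hb, hr, -⟩ | ⟨s, hs, hr, -⟩, -, -⟩ := C.program.exists_rule_of_step h
  · exact C.inSecondPass_of_blindRule hr (hb ▸ hc)
  · exact C.inSecondPass_of_sightedRule hr (hs ▸ hc)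

/-- A left move can only enter a state of `InSecondPass`. This set is closed under steps, and none
of its states is entered by a right move. -/
theorem twoPass : C.program.toInputTM.TwoPass := by
  intro w c c' d d' _ h hlt hd h'
  have hc' : InSecondPass c'.state := by
    apply inSecondPass_of_entry
    have := C.program.inHead_of_step h
    change _ = _ + entryMove (entry c'.state) at this
    rcases he : entry c'.state with _ | _ | _ <;> simp [he, entryMove] at this ⊢ <;> omega
  have hd' : InSecondPass d'.state := by
    refine C.inSecondPass_step h' ?_
    clear h'
    induction hd with
    | refl => exact hc'
    | tail _ hs ih => exact C.inSecondPass_step hs ih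
  have := C.program.inHead_of_step h'
  change _ = _ + entryMove (entry d'.state) at this
  have hne : entryMove (entry d'.state) ≤ 0 := by
    generalize d'.state = q at hd'
    unfold entry
    split <;> first | exact hd'.elim | simp [entryMove]
  omega

/-- A configuration of the reversible two-pass machine. -/
noncomputable abbrev cfg (q : State (BlindState Y) SightedState.{u}) (i : ℤ) (t : Tape Γ)
    (h : Tape (Option (Y × Option Γ))) (o : Tape Γ) : C.program.toInputTM.Dyn :=
  C.program.cfg q i t h o

theorem step_blind {b : BlindState Y} {q : State (BlindState Y) SightedState.{u}}
    {t : Tape Γ} {h : Tape (Option (Y × Option Γ))} {o : Tape Γ}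
    {x y : Option Γ} {l : Option (Option (Y × Option Γ))} (w : List A) (i : ℤ)
    (hr : C.blindRule b (t.read, h.read, o.read) = some (q, x, l, y)) (he : entry q = none) :
    C.program.toInputTM.step w (C.cfg (.blind b) i t h o) =
      some (C.cfg q i (t.act x (C.moves q).1) (h.act l (C.moves q).2.1)
        (o.act y (C.moves q).2.2)) :=
  C.program.step_blind w i hr he

theorem step_sighted {s : SightedState.{u}} {q : State (BlindState Y) SightedState.{u}}
    {t : Tape Γ} {h : Tape (Option (Y × Option Γ))} {o : Tape Γ}
    {x y : Option Γ} {l : Option (Option (Y × Option Γ))} {w : List A} {i : ℤ} {d : Turing.Dir}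
    (hr : C.sightedRule s ((Tape.ofWord w).cells i) (t.read, h.read, o.read) = some (q, x, l, y))
    (he : entry q = some d) :
    C.program.toInputTM.step w (C.cfg (.sighted s) i t h o) =
      some (C.cfg q (i + entryMove (some d)) (t.act x (C.moves q).1) (h.act l (C.moves q).2.1)
        (o.act y (C.moves q).2.2)) :=
  C.program.step_sighted hr he

/-- Reachability for the reversible two-pass machine. -/
abbrev Reach (w : List A) (c c' : C.program.toInputTM.Dyn) : Prop :=
  Reaches (C.program.toInputTM.step w) c c'

/-! ### Forward and backward simulation -/

/-- All cells from the head on are blank. -/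
def FreshTape {α : Type u} (h : Tape α) : Prop := ∀ z, h.head ≤ z → h.cells z = none

theorem FreshTape.act {α : Type u} {h : Tape α} (hh : FreshTape h) (s : Option α) :
    FreshTape (h.act s 1) := by
  intro z hz
  have hz' : h.head + 1 ≤ z := hz
  simp only [Tape.act]
  rw [Function.update_of_ne (by omega)]
  exact hh z (by omega)

/-- The configuration at the start of a simulation step. -/
noncomputable abbrev forward (y : Y) (t : Tape Γ) (i : ℤ) (h : Tape (Option (Y × Option Γ)))
    (o : Tape Γ) : C.program.toInputTM.Dyn :=
  C.cfg (.blind (sim y)) i t h o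

/-- The configuration before a backward simulation step. -/
noncomputable abbrev backward (v : Bool) (y : Y) (t : Tape Γ) (i : ℤ)
    (h : Tape (Option (Y × Option Γ))) (o : Tape Γ) : C.program.toInputTM.Dyn :=
  C.cfg (.blind (back v y)) i (t.shift (-C.move y : SignType)) (h.shift (-1 : SignType)) o

theorem act_read_zero {α : Type u} (t : Tape α) : t.act t.read 0 = t := by
  simp [Tape.act, Tape.read]

theorem step_forward {y : Y} {t : Tape Γ} {h : Tape (Option (Y × Option Γ))}
    (w : List A) (i : ℤ) (o : Tape Γ) (hy : C.verdict y = none) (hh : FreshTape h) :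
    C.program.toInputTM.step w (C.forward y t i h o) =
      some (C.forward (C.next y t.read).1 (t.act (C.next y t.read).2 (C.move (C.next y t.read).1)) i
        (h.act (some (some (y, t.read))) 1) o) := by
  have hr : h.read = none := hh _ le_rfl
  refine (C.step_blind w i (q := .blind (sim (C.next y t.read).1)) (x := (C.next y t.read).2)
    (l := some (some (y, t.read))) (y := o.read) ?_ rfl).trans ?_
  · rw [hr]
    simp only [blindRule, hy]
  · simp only [moves, act_read_zero]

/-- Entering a `back` state undoes the head moves of the corresponding `sim` state in advance, so
the heads scan the symbol and the record that the forward step wrote. -/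
theorem step_backward {y : Y} {t : Tape Γ} {h : Tape (Option (Y × Option Γ))}
    (w : List A) (v : Bool) (i : ℤ) (o : Tape Γ) (hy : C.verdict y = none) (hh : FreshTape h) :
    C.program.toInputTM.step w (C.backward v (C.next y t.read).1
        (t.act (C.next y t.read).2 (C.move (C.next y t.read).1)) i
        (h.act (some (some (y, t.read))) 1) o) =
      some (C.backward v y t i h o) := by
  have hr : h.read = none := hh _ le_rfl
  refine (C.step_blind w i (q := .blind (back v y)) (x := t.read) (l := none) (y := o.read)
    ?_ rfl).trans ?_
  · rw [Tape.read_act_shift, Tape.read_act_shift]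
    simp [blindRule, hy]
  · have h2 := Tape.act_shift_act h (some (some (y, t.read))) 1 (-1)
    rw [hr] at h2
    simp only [moves, act_read_zero, Tape.act_shift_act, h2]

/-- The machine simulates the process from `(y, t)` to `(y', t')`, and simulates it backwards. -/
def Simulates (w : List A) (y : Y) (t : Tape Γ) (y' : Y) (t' : Tape Γ) : Prop :=
  ∀ h : Tape (Option (Y × Option Γ)), FreshTape h → ∃ h', FreshTape h' ∧
    ∀ i, (∀ o, C.Reach w (C.forward y t i h o) (C.forward y' t' i h' o)) ∧
      ∀ v o, C.Reach w (C.backward v y' t' i h' o) (C.backward v y t i h o)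

theorem Simulates.refl (w : List A) (y : Y) (t : Tape Γ) : C.Simulates w y t y t :=
  fun h hh => ⟨h, hh, fun _ => ⟨fun _ => .refl, fun _ _ => .refl⟩⟩

variable {C} in
theorem Simulates.trans {w : List A} {y y' y'' : Y} {t t' t'' : Tape Γ}
    (h₁ : C.Simulates w y t y' t') (h₂ : C.Simulates w y' t' y'' t'') :
    C.Simulates w y t y'' t'' := by
  intro h hh
  obtain ⟨h', hh', k'⟩ := h₁ h hh
  obtain ⟨h'', hh'', k''⟩ := h₂ h' hh'
  exact ⟨h'', hh'', fun i => ⟨fun o => ((k' i).1 o).trans ((k'' i).1 o),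
    fun v o => ((k'' i).2 v o).trans ((k' i).2 v o)⟩⟩

/-- The new history tape is chosen before the output tape. The record of a run with empty output can
therefore drive the backward run with the output in place. -/
theorem simulates_step {y : Y} (w : List A) (t : Tape Γ) (hy : C.verdict y = none) :
    C.Simulates w y t (C.next y t.read).1
      (t.act (C.next y t.read).2 (C.move (C.next y t.read).1)) := fun h hh =>
  ⟨h.act (some (some (y, t.read))) 1, hh.act _, fun i =>
    ⟨fun o => .single (C.step_forward w i o hy hh),
      fun v o => .single (C.step_backward w v i o hy hh)⟩⟩

end Simulation

/-! ### Tapes containing a word -/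

namespace Tape

variable {α : Type u}

/-- The word `l` in the cells `0, …, l.length - 1` and the head on cell `i`. -/
def wordAt (l : List α) (i : ℤ) : Tape α where
  cells := (ofWord l).cells
  head := i

theorem ofWord_cells_natCast (l : List α) (n : ℕ) : (ofWord l).cells n = l[n]? := by
  simp [ofWord]

theorem ofWord_cells_neg_one (l : List α) : (ofWord l).cells (-1) = none := by
  simp [ofWord]

theorem read_wordAt_natCast (l : List α) (n : ℕ) : (wordAt l n).read = l[n]? :=
  ofWord_cells_natCast l n

theorem read_wordAt_neg_one (l : List α) : (wordAt l (-1)).read = none :=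
  ofWord_cells_neg_one l

theorem blank_eq_wordAt : (blank : Tape α) = wordAt [] 0 := by
  ext1
  · funext z
    simp [blank, wordAt, ofWord]
  · rfl

theorem act_wordAt_append (l : List α) (a : α) (d : SignType) :
    (wordAt l l.length).act (some a) d = wordAt (l ++ [a]) (l.length + d) := by
  ext1
  · funext z
    simp only [act, wordAt, ofWord, Function.update_apply]
    split_ifs with h1 h2 h2
    · simp [h1]
    · omega
    · rcases lt_or_ge z.toNat l.length with h | h
      · rw [List.getElem?_append_left h]
      · rw [List.getElem?_eq_none h, List.getElem?_eq_none]
        simp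
        omega
    · rfl
  · rfl

theorem act_none_wordAt_append (l : List α) (a : α) (d : SignType) :
    (wordAt (l ++ [a]) l.length).act none d = wordAt l (l.length + d) := by
  have h := act_wordAt_append l a 0
  have h0 : wordAt (l ++ [a]) l.length = (wordAt l l.length).act (some a) 0 := by
    rw [h]
    simp
  have h1 : (wordAt l l.length).cells l.length = none := by
    simp [wordAt, ofWord]
  rw [h0]
  ext1
  · simp only [act, SignType.coe_zero, add_zero, Function.update_idem]
    exact Function.update_eq_self_iff.2 h1.symm
  · simp [act, wordAt]

theorem shift_wordAt (l : List α) (i j : ℤ) : (wordAt l i).shift j = wordAt l (i + j) := rfl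

theorem shift_shift (t : Tape α) (i j : ℤ) : (t.shift i).shift j = t.shift (i + j) := by
  simp [shift, add_assoc]

theorem shift_zero (t : Tape α) : t.shift 0 = t := by
  simp [shift]

end Tape

/-! ### The phases: loading, unloading, copying the output -/

namespace Simulation

variable {A Γ Y : Type u} (C : Simulation A Γ Y) [Finite Γ] [Finite Y]

open BlindState SightedState StateTransition Tape

theorem reach_load (w l r : List A) (hw : w = l ++ r) (h : Tape (Option (Y × Option Γ)))
    (o : Tape Γ) :
    C.Reach w (C.cfg (.sighted load) l.length (wordAt (l.map C.embed) l.length) h o)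
      (C.cfg (.sighted load) w.length (wordAt (w.map C.embed) w.length) h o) := by
  induction r generalizing l with
  | nil =>
    simp only [List.append_nil] at hw
    subst hw
    exact .refl
  | cons a r ih =>
    refine .trans (.single ?_) (ih (l ++ [a]) (by simp [hw]))
    refine (C.step_sighted (q := .sighted load) (x := some (C.embed a)) (l := h.read)
      (y := o.read) ?_ rfl).trans ?_
    · have h1 := read_wordAt_natCast (l.map C.embed) l.length
      rw [List.getElem?_eq_none (by simp)] at h1
      rw [h1, ofWord_cells_natCast, hw]
      simp [sightedRule]
    · have h1 := act_wordAt_append (l.map C.embed) (C.embed a) 1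
      simp only [List.length_map] at h1
      simp [moves, h1, entryMove, act_read, shift_zero]

/-- Induction from the right end: the two heads stand on matching cells, so the comparison demanded
by `unload` succeeds. The blank to the left of the copy ends the loop. -/
theorem reach_unload (w l r : List A) (hw : w = l ++ r) (v : Bool)
    (h : Tape (Option (Y × Option Γ))) (o : Tape Γ) :
    C.Reach w (C.cfg (.blind (erase v)) (l.length - 1) (wordAt (l.map C.embed) (l.length - 1)) h o)
      (C.cfg (.blind (erase v)) (-1) (wordAt [] (-1)) h o) := by
  induction l using List.reverseRecOn generalizing r with
  | nil => exact .refl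
  | append_singleton l a ih =>
    refine .trans (.head (b := C.cfg (.sighted (unload v)) l.length
      (wordAt ((l ++ [a]).map C.embed) l.length) h o) ?_ (.single ?_)) (ih (a :: r) (by simp [hw]))
    · have h1 := read_wordAt_natCast ((l ++ [a]).map C.embed) l.length
      simp only [List.length_append, List.length_singleton, Nat.cast_add, Nat.cast_one,
        add_sub_cancel_right]
      refine (C.step_blind w _ (q := .sighted (unload v))
        (x := (wordAt ((l ++ [a]).map C.embed) l.length).read) (l := h.read)
        (y := o.read) ?_ rfl).trans ?_
      · rw [h1]
        simp [blindRule]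
      · simp [moves, act_read, shift_zero]
    · have h1 := read_wordAt_natCast ((l ++ [a]).map C.embed) l.length
      refine (C.step_sighted (q := .blind (erase v)) (x := none) (l := h.read)
        (y := o.read) ?_ rfl).trans ?_
      · rw [h1, ofWord_cells_natCast, hw]
        simp [sightedRule]
      · have h1 := act_none_wordAt_append (l.map C.embed) (C.embed a) (-1)
        simp only [List.length_map] at h1
        simp [moves, h1, entryMove, sub_eq_add_neg, act_read, shift_zero]

/-- The history tape that contains only the marker. -/
def markedTape : Tape (Option (Y × Option Γ)) := blank.act (some none) 1

omit [Finite Γ] [Finite Y] in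
theorem freshTape_markedTape : FreshTape (markedTape : Tape (Option (Y × Option Γ))) :=
  FreshTape.act (h := blank) (fun _ _ => rfl) _

theorem init_eq_cfg :
    C.program.toInputTM.init = C.cfg (.blind start) (-1) blank blank blank := by
  ext1
  · rfl
  · rfl
  · funext j
    fin_cases j <;> rfl
  · rfl

theorem final_eq_cfg (v : Bool) (y : List Γ) :
    C.program.toInputTM.final v y =
      C.cfg (if v then .acc else .rej) (-1) blank blank (ofWord y) := by
  ext1
  · rfl
  · rfl
  · funext j
    fin_cases j <;> rfl
  · rfl

theorem reach_first_pass (w : List A) :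
    C.Reach w C.program.toInputTM.init
      (C.forward C.entrance ((wordAt (w.map C.embed) w.length).shift (C.move C.entrance))
        (w.length + 1) markedTape blank) := by
  rw [init_eq_cfg]
  refine .head (b := C.cfg (.sighted first) (-1) (wordAt [] (-1)) blank blank) ?_
    (.head (b := C.cfg (.sighted load) ([] : List A).length
      (wordAt (([] : List A).map C.embed) ([] : List A).length) blank blank) ?_
    (.trans (C.reach_load w [] w rfl blank blank)
    (.head (b := C.cfg (.blind enter) (w.length + 1) (wordAt (w.map C.embed) w.length)
      blank blank) ?_ (.single ?_))))
  · refine (C.step_blind w _ (q := .sighted first) (x := (blank : Tape Γ).read)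
      (l := (blank : Tape (Option (Y × Option Γ))).read) (y := (blank : Tape Γ).read)
      rfl rfl).trans ?_
    simp [moves, act_read, shift_zero]
    rw [blank_eq_wordAt, shift_wordAt]
    rfl
  · refine (C.step_sighted (q := .sighted load) (x := (wordAt ([] : List Γ) (-1)).read)
      (l := (blank : Tape (Option (Y × Option Γ))).read) (y := (blank : Tape Γ).read)
      ?_ rfl).trans ?_
    · rw [ofWord_cells_neg_one]
      rfl
    · simp [moves, entryMove, shift_wordAt, act_read, shift_zero]
  · refine (C.step_sighted (q := .blind enter) (x := (wordAt (w.map C.embed) w.length).read)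
      (l := (blank : Tape (Option (Y × Option Γ))).read) (y := (blank : Tape Γ).read)
      ?_ rfl).trans ?_
    · rw [ofWord_cells_natCast, List.getElem?_eq_none le_rfl]
      rfl
    · simp [moves, entryMove, act_read, shift_zero]
  · refine (C.step_blind w _ (q := .blind (sim C.entrance))
      (x := (wordAt (w.map C.embed) w.length).read) (l := some none) (y := (blank : Tape Γ).read)
      rfl rfl).trans ?_
    simp [moves, markedTape, shift_wordAt, act_read, shift_zero]

theorem reach_second_pass (w : List A) (v : Bool) (o : Tape Γ) :
    C.Reach w (C.backward v C.entrance
        ((wordAt (w.map C.embed) w.length).shift (C.move C.entrance)) (w.length + 1) markedTape o)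
      (C.cfg (if v then .acc else .rej) (-1) blank blank o) := by
  have ht : ((wordAt (w.map C.embed) w.length).shift (C.move C.entrance)).shift
      (-C.move C.entrance : SignType) = wordAt (w.map C.embed) w.length := by
    rw [shift_shift, SignType.coe_neg, add_neg_cancel, shift_zero]
  have hh : ((markedTape : Tape (Option (Y × Option Γ))).shift (-1 : SignType)).read = some none :=
    read_act_shift _ _ _
  have hh' : ((markedTape : Tape (Option (Y × Option Γ))).shift (-1)).act none 0 = blank :=
    (act_shift_act (blank : Tape (Option (Y × Option Γ))) (some none) 1 0).trans (shift_zero _)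
  unfold backward
  rw [ht]
  refine .head (b := C.cfg (.sighted (turn v)) (w.length + 1) (wordAt (w.map C.embed) w.length)
      blank o) ?_
    (.head (b := C.cfg (.sighted (second v)) w.length (wordAt (w.map C.embed) w.length)
      blank o) ?_
    (.head (b := C.cfg (.blind (erase v)) (w.length - 1)
      (wordAt (w.map C.embed) (w.length - 1)) blank o) ?_
    (.trans (C.reach_unload w w [] (by simp) v blank o) (.single ?_))))
  · refine (C.step_blind w _ (q := .sighted (turn v))
      (x := (wordAt (w.map C.embed) w.length).read) (l := none) (y := o.read) ?_ rfl).trans ?_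
    · rw [hh]
      simp [blindRule]
    · simp [moves, hh', act_read, shift_zero]
  · refine (C.step_sighted (q := .sighted (second v)) (x := (wordAt (w.map C.embed) w.length).read)
      (l := (blank : Tape (Option (Y × Option Γ))).read) (y := o.read) ?_ rfl).trans ?_
    · have := ofWord_cells_natCast w (w.length + 1)
      rw [List.getElem?_eq_none (by omega)] at this
      rw [← Nat.cast_succ, Nat.succ_eq_add_one, this]
      rfl
    · simp [moves, entryMove, act_read, shift_zero]
  · refine (C.step_sighted (q := .blind (erase v)) (x := (wordAt (w.map C.embed) w.length).read)
      (l := (blank : Tape (Option (Y × Option Γ))).read) (y := o.read) ?_ rfl).trans ?_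
    · rw [ofWord_cells_natCast, List.getElem?_eq_none le_rfl]
      rfl
    · simp [moves, entryMove, sub_eq_add_neg, shift_wordAt, act_read, shift_zero]
  · refine (C.step_blind w _ (q := if v then .acc else .rej)
      (x := (wordAt ([] : List Γ) (-1)).read)
      (l := (blank : Tape (Option (Y × Option Γ))).read) (y := o.read) ?_ ?_).trans ?_
    · rw [read_wordAt_neg_one]
      cases v <;> rfl
    · cases v <;> rfl
    · have : C.moves (if v then .acc else .rej) = (1, 0, 0) := by cases v <;> rfl
      rw [this]
      simp [act_read, shift_wordAt, shift_zero, blank_eq_wordAt (α := Γ)]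

theorem reach_copy (w : List A) (z : Y) (t : Tape Γ) (i : ℤ) (h : Tape (Option (Y × Option Γ)))
    (y l r : List Γ) (hy : y = l ++ r)
    (he : ∀ n : ℕ, n ≤ y.length → C.emit (t.cells (t.head + n)) = y[n]?) :
    C.Reach w (C.cfg (.blind (copy z)) i (t.shift l.length) h (wordAt l l.length))
      (C.cfg (.blind (copy z)) i (t.shift y.length) h (wordAt y y.length)) := by
  induction r generalizing l with
  | nil =>
    simp only [List.append_nil] at hy
    subst hy
    exact .refl
  | cons a r ih =>
    refine .trans (.single ?_) (ih (l ++ [a]) (by simp [hy]))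
    refine (C.step_blind w i (q := .blind (copy z)) (x := (t.shift l.length).read) (l := h.read)
      (y := some a) ?_ rfl).trans ?_
    · have h1 : C.emit (t.shift l.length).read = some a := by
        refine (he l.length (by simp [hy])).trans ?_
        simp [hy]
      rw [read_wordAt_natCast, List.getElem?_eq_none le_rfl]
      simp only [blindRule, h1]
    · simp [moves, act_wordAt_append, act_read, shift_shift, shift_zero]

theorem reach_rewind (w : List A) (z : Y) (t : Tape Γ) (i : ℤ)
    (h : Tape (Option (Y × Option Γ))) (y : List Γ) (n : ℕ) (hn : n ≤ y.length) :
    C.Reach w (C.cfg (.blind (rewind z)) i (t.shift (n - 1)) h (wordAt y (n - 1)))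
      (C.cfg (.blind (rewind z)) i (t.shift (-1)) h (wordAt y (-1))) := by
  induction n with
  | zero => exact .refl
  | succ n ih =>
    refine .head ?_ (ih (by omega))
    simp only [Nat.cast_add, Nat.cast_one, add_sub_cancel_right]
    refine (C.step_blind w i (q := .blind (rewind z)) (x := (t.shift n).read) (l := h.read)
      (y := (wordAt y n).read) ?_ rfl).trans ?_
    · rw [read_wordAt_natCast, List.getElem?_eq_getElem (by omega)]
      rfl
    · simp [moves, sub_eq_add_neg, shift_wordAt, act_read, shift_shift, shift_zero]

/-- The output phase, from the end of the simulation to the start of the backward simulation. -/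
theorem reach_backward_of_verdict (w : List A) (z : Y) (v : Bool) (hz : C.verdict z = some v)
    (t : Tape Γ) (i : ℤ) (h : Tape (Option (Y × Option Γ))) (y : List Γ)
    (he : ∀ n : ℕ, n ≤ y.length → C.emit (t.cells (t.head + n)) = y[n]?) :
    C.Reach w (C.forward z t i h blank) (C.backward v z t i h (ofWord y)) := by
  refine .head (b := C.cfg (.blind (halted z)) i (t.shift (-1)) h (wordAt [] (-1))) ?_
    (.head (b := C.cfg (.blind (copy z)) i (t.shift ([] : List Γ).length) h
      (wordAt [] ([] : List Γ).length)) ?_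
    (.trans (C.reach_copy w z t i h y [] y rfl he)
    (.head (b := C.cfg (.blind (rewind z)) i (t.shift (y.length - 1)) h
      (wordAt y (y.length - 1))) ?_
    (.trans (C.reach_rewind w z t i h y y.length le_rfl)
    (.head (b := C.cfg (.blind (copied z)) i t h (wordAt y 0)) ?_ (.single ?_))))))
  · rw [blank_eq_wordAt]
    refine (C.step_blind w i (q := .blind (halted z)) (x := t.read) (l := h.read)
      (y := (wordAt ([] : List Γ) 0).read) ?_ rfl).trans ?_
    · rw [← Nat.cast_zero, read_wordAt_natCast]
      simp [blindRule, hz]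
    · simp [moves, shift_wordAt, act_read, shift_zero]
  · refine (C.step_blind w i (q := .blind (copy z)) (x := (t.shift (-1)).read) (l := h.read)
      (y := (wordAt ([] : List Γ) (-1)).read) ?_ rfl).trans ?_
    · rw [read_wordAt_neg_one]
      rfl
    · simp [moves, shift_wordAt, act_read, shift_shift, shift_zero]
  · refine (C.step_blind w i (q := .blind (rewind z)) (x := (t.shift y.length).read) (l := h.read)
      (y := (wordAt y y.length).read) ?_ rfl).trans ?_
    · have h1 : C.emit (t.shift y.length).read = none := by
        refine (he y.length le_rfl).trans ?_
        simp
      rw [read_wordAt_natCast, List.getElem?_eq_none le_rfl]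
      simp only [blindRule, h1]
    · simp [moves, sub_eq_add_neg, shift_wordAt, act_read, shift_shift, shift_zero]
  · refine (C.step_blind w i (q := .blind (copied z)) (x := (t.shift (-1)).read) (l := h.read)
      (y := (wordAt y (-1)).read) ?_ rfl).trans ?_
    · rw [read_wordAt_neg_one]
      rfl
    · simp [moves, shift_wordAt, act_read, shift_shift, shift_zero]
  · refine (C.step_blind w i (q := .blind (back v z)) (x := t.read) (l := h.read)
      (y := (wordAt y 0).read) ?_ rfl).trans ?_
    · simp [blindRule, hz]
    · simp only [moves, act_read, SignType.coe_zero, shift_zero]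
      rfl

end Simulation

/-! ### Maximal blank-free words -/

/-- `y` is the longest word that is an initial segment of `f`. -/
def IsInitialWord {α : Type u} (f : ℕ → Option α) (y : List α) : Prop :=
  ∀ n ≤ y.length, f n = y[n]?

theorem exists_isInitialWord {α : Type u} (f : ℕ → Option α) (k : ℕ) (hk : f k = none) :
    ∃ y, IsInitialWord f y := by
  induction k generalizing f with
  | zero =>
    refine ⟨[], fun n hn => ?_⟩
    obtain rfl : n = 0 := by simpa using hn
    simpa using hk
  | succ k ih =>
    rcases h0 : f 0 with _ | a
    · refine ⟨[], fun n hn => ?_⟩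
      obtain rfl : n = 0 := by simpa using hn
      simpa using h0
    · obtain ⟨y, hy⟩ := ih (fun n => f (n + 1)) hk
      refine ⟨a :: y, fun n hn => ?_⟩
      rcases n with _ | n
      · simpa using h0
      · simpa using hy n (by simpa using hn)

theorem IsInitialWord.length_le {α : Type u} {f : ℕ → Option α} {y y' : List α}
    (h : IsInitialWord f y) (h' : IsInitialWord f y') : y'.length ≤ y.length := by
  by_contra! hlt
  have h1 := h y.length le_rfl
  rw [h' _ hlt.le, List.getElem?_eq_none le_rfl, List.getElem?_eq_none_iff] at h1
  omega

theorem IsInitialWord.unique {α : Type u} {f : ℕ → Option α} {y y' : List α}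
    (h : IsInitialWord f y) (h' : IsInitialWord f y') : y = y' := by
  have hl := le_antisymm (h'.length_le h) (h.length_le h')
  refine List.ext_getElem? fun n => ?_
  rcases le_or_gt n y.length with hn | hn
  · rw [← h n hn, h' n (hl ▸ hn)]
  · rw [List.getElem?_eq_none hn.le, List.getElem?_eq_none (by omega)]

/-! ### Application to a one-tape machine -/

namespace OneTapeTM

variable {A Γ Q : Type u} (M : OneTapeTM A Γ Q) (emit : Option Γ → Option Γ)

open StateTransition Tape

open Classical in
/-- The simulated process: rewind the tape to the beginning of the input, then run the machine. -/
noncomputable def simulation : Simulation A Γ (Option Q × SignType) where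
  embed := M.embed
  -- A control state carries the move by which it is entered, since moves may depend on the new
  -- state only. The component `none` is the rewinding phase.
  entrance := (none, -1)
  move y := y.2
  verdict
    | (none, _) => none
    | (some q, _) => if q = M.acc then some true else if q = M.rej then some false else none
  next
    | (none, _), some a => ((none, -1), some a)
    | (none, _), none => ((some M.start, 1), none)
    | (some q, _), s => ((some (M.δ q s).1, (M.δ q s).2.2), (M.δ q s).2.1)
  emit := emit

theorem verdict_haltState (v : Bool) (d : SignType) :
    (M.simulation emit).verdict (some (M.haltState v), d) = some v := by
  cases v
  · simp [simulation, haltState, M.acc_ne_rej.symm]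
  · simp [simulation, haltState]

theorem step_eq_some {q : Q} {t : Tape Γ} {c : Q × Tape Γ} (h : M.step (q, t) = some c) :
    (q ≠ M.acc ∧ q ≠ M.rej) ∧
      c = ((M.δ q t.read).1, t.act (M.δ q t.read).2.1 (M.δ q t.read).2.2) := by
  unfold step at h
  split_ifs at h with hq
  exact ⟨not_or.1 hq, (Option.some.inj h).symm⟩

theorem step_of_ne {q : Q} (h : q ≠ M.acc ∧ q ≠ M.rej) (t : Tape Γ) :
    M.step (q, t) = some ((M.δ q t.read).1, t.act (M.δ q t.read).2.1 (M.δ q t.read).2.2) :=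
  if_neg (not_or.2 h)

theorem verdict_of_ne {q : Q} (h : q ≠ M.acc ∧ q ≠ M.rej) (d : SignType) :
    (M.simulation emit).verdict (some q, d) = none := by
  simp [simulation, h.1, h.2]

/-- A step changes one cell only, so the tape stays blank far to the right. This bounds the output
word. -/
theorem exists_blank_of_reaches {w : List A} {c : Q × Tape Γ}
    (h : Reaches M.step (M.init w) c) : ∃ N : ℤ, ∀ z, N ≤ z → c.2.cells z = none := by
  induction h with
  | refl =>
    refine ⟨w.length, fun z hz => ?_⟩
    have : w.length ≤ z.toNat := by omega
    simp [init, ofWord, this]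
  | @tail b c _ hs ih =>
    obtain ⟨N, hN⟩ := ih
    obtain ⟨-, rfl⟩ := M.step_eq_some hs
    refine ⟨max N (b.2.head + 1), fun z hz => ?_⟩
    simp only [act]
    rw [Function.update_of_ne (by omega)]
    exact hN z (by omega)

/-- The output word of a halting computation exists. -/
theorem exists_output (hemit : emit none = none) {w : List A} {c : Q × Tape Γ}
    (h : Reaches M.step (M.init w) c) :
    ∃ y, IsInitialWord (fun n : ℕ => emit (c.2.cells (c.2.head + n))) y := by
  obtain ⟨N, hN⟩ := M.exists_blank_of_reaches h
  refine exists_isInitialWord _ (N - c.2.head).toNat ?_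
  rw [hN _ (by omega), hemit]

variable [Finite Γ] [Finite Q]

theorem simulates_rewind (w : List A) (l : List Γ) (n : ℕ) (hn : n ≤ l.length) :
    (M.simulation emit).Simulates w (none, -1) (wordAt l (n - 1)) (none, -1) (wordAt l (-1)) := by
  induction n with
  | zero => exact .refl _ _ _ _
  | succ n ih =>
    refine .trans ?_ (ih (by omega))
    have h1 := (M.simulation emit).simulates_step (y := (none, -1)) w
      (wordAt l ((n + 1 : ℕ) - 1)) rfl
    have h2 : (wordAt l n).read = some l[n] := by
      rw [read_wordAt_natCast, List.getElem?_eq_getElem (by omega)]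
    have h3 := act_read (wordAt l n) (-1)
    simp only [Nat.cast_add, Nat.cast_one, add_sub_cancel_right] at h1 ⊢
    rw [h2] at h1 h3
    change (M.simulation emit).Simulates w _ _ (none, -1) ((wordAt l n).act (some l[n]) (-1)) at h1
    rw [h3] at h1
    exact h1

theorem simulates_init (w : List A) :
    (M.simulation emit).Simulates w (M.simulation emit).entrance
      ((wordAt (w.map M.embed) w.length).shift
        ((M.simulation emit).move (M.simulation emit).entrance))
      (some M.start, 1) (ofWord (w.map M.embed)) := by
  have h1 := M.simulates_rewind emit w (w.map M.embed) w.length (by simp)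
  refine .trans h1 ?_
  have h2 := (M.simulation emit).simulates_step (y := (none, -1)) w
    (wordAt (w.map M.embed) (-1)) rfl
  have h3 := act_read (wordAt (w.map M.embed) (-1)) 1
  rw [read_wordAt_neg_one] at h2 h3
  change (M.simulation emit).Simulates w _ _ (some M.start, 1)
    ((wordAt (w.map M.embed) (-1)).act none 1) at h2
  rw [h3] at h2
  exact h2

theorem simulates_step_of_ne {q : Q} (w : List A) (h : q ≠ M.acc ∧ q ≠ M.rej) (t : Tape Γ)
    (d : SignType) :
    (M.simulation emit).Simulates w (some q, d) t (some (M.δ q t.read).1, (M.δ q t.read).2.2)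
      (t.act (M.δ q t.read).2.1 (M.δ q t.read).2.2) :=
  (M.simulation emit).simulates_step w t (M.verdict_of_ne emit h d)

theorem simulates_of_reaches (w : List A) {c c' : Q × Tape Γ} (h : Reaches M.step c c')
    (d : SignType) :
    ∃ d', (M.simulation emit).Simulates w (some c.1, d) c.2 (some c'.1, d') c'.2 := by
  induction h with
  | refl => exact ⟨d, .refl _ _ _ _⟩
  | @tail b c' _ hs ih =>
    obtain ⟨d', hd'⟩ := ih
    obtain ⟨hne, rfl⟩ := M.step_eq_some hs
    exact ⟨_, hd'.trans (M.simulates_step_of_ne emit w hne b.2 d')⟩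

theorem reach_final {w : List A} {v : Bool} {t : Tape Γ} {y : List Γ}
    (h : Reaches M.step (M.init w) (M.haltState v, t))
    (hy : IsInitialWord (fun n : ℕ => emit (t.cells (t.head + n))) y) :
    (M.simulation emit).Reach w (M.simulation emit).program.toInputTM.init
      ((M.simulation emit).program.toInputTM.final v y) := by
  obtain ⟨d, hd⟩ := M.simulates_of_reaches emit w h 1
  obtain ⟨l, -, hl⟩ := (M.simulates_init emit w).trans hd _ Simulation.freshTape_markedTape
  have hl := hl (w.length + 1)
  rw [Simulation.final_eq_cfg]
  exact ((Simulation.reach_first_pass _ w).trans (hl.1 _)).trans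
    (((Simulation.reach_backward_of_verdict _ w _ v (M.verdict_haltState emit v d) t _ l y hy).trans
      (hl.2 _ _)).trans (Simulation.reach_second_pass _ w v _))

/-- If the machine does not halt, then neither does the reversible machine. -/
theorem step_ne_none_of_not_halting {w : List A}
    (h : ∀ v t, ¬ Reaches M.step (M.init w) (M.haltState v, t))
    {c : (M.simulation emit).program.toInputTM.Dyn}
    (hc : (M.simulation emit).Reach w (M.simulation emit).program.toInputTM.init c) :
    (M.simulation emit).program.toInputTM.step w c ≠ none := by
  have hne : ∀ b, Reaches M.step (M.init w) b → b.1 ≠ M.acc ∧ b.1 ≠ M.rej := fun b hb =>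
    ⟨fun e => h true b.2 (by rwa [haltState, if_pos rfl, ← e]),
      fun e => h false b.2 (by rwa [haltState, if_neg Bool.false_ne_true, ← e])⟩
  -- The invariant of an endless run: the machine is in its forward phase, mirroring a reachable
  -- configuration of `M`.
  let Running (c : (M.simulation emit).program.toInputTM.Dyn) : Prop :=
    ∃ b d l, Reaches M.step (M.init w) b ∧ Simulation.FreshTape l ∧
      c = (M.simulation emit).forward (some b.1, d) b.2 (w.length + 1) l blank
  have hstep : ∀ c, Running c →
      ∃ c', (M.simulation emit).program.toInputTM.step w c = some c' ∧ Running c' := by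
    rintro c ⟨b, d, l, hb, hl, rfl⟩
    exact ⟨_, (M.simulation emit).step_forward w _ blank (M.verdict_of_ne emit (hne b hb) d) hl,
      _, _, _, hb.tail (M.step_of_ne (hne b hb) b.2), hl.act _, rfl⟩
  obtain ⟨l, hl, hr⟩ := M.simulates_init emit w _ Simulation.freshTape_markedTape
  have h0 := (Simulation.reach_first_pass _ w).trans ((hr (w.length + 1)).1 blank)
  have hrun : Running ((M.simulation emit).forward (some M.start, 1) (ofWord (w.map M.embed))
    (w.length + 1) l blank) := ⟨M.init w, 1, l, .refl, hl, rfl⟩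
  intro hnone
  have key : ∀ c', (M.simulation emit).Reach w
      ((M.simulation emit).forward (some M.start, 1) (ofWord (w.map M.embed))
        (w.length + 1) l blank) c' → Running c' := by
    intro c' hc'
    induction hc' with
    | refl => exact hrun
    | tail _ hs ih =>
      obtain ⟨c'', hs', hc''⟩ := hstep _ ih
      obtain rfl := Option.some.inj (hs.symm.trans hs')
      exact hc''
  have hrc : Running c := by
    -- By determinism `c` lies after or before the start of the simulation; in the second case it is
    -- that start, or it has a successor.
    rcases reaches_total h0 hc with h1 | h1
    · exact key c h1
    · rcases Relation.ReflTransGen.cases_head h1 with rfl | ⟨c', hs, -⟩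
      · exact hrun
      · rw [Option.mem_def, hnone] at hs
        cases hs
  obtain ⟨c', hs, -⟩ := hstep c hrc
  rw [hnone] at hs
  cases hs

/-- A computation of the reversible machine that stops has reached the result of the simulated
machine. -/
theorem eq_final_of_halting (hemit : emit none = none) {w : List A}
    {c : (M.simulation emit).program.toInputTM.Dyn}
    (hc : (M.simulation emit).Reach w (M.simulation emit).program.toInputTM.init c)
    (hs : (M.simulation emit).program.toInputTM.step w c = none) :
    ∃ v t y, Reaches M.step (M.init w) (M.haltState v, t) ∧
      IsInitialWord (fun n : ℕ => emit (t.cells (t.head + n))) y ∧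
      c = (M.simulation emit).program.toInputTM.final v y := by
  by_cases h : ∃ v t, Reaches M.step (M.init w) (M.haltState v, t)
  · obtain ⟨v, t, h⟩ := h
    obtain ⟨y, hy⟩ := M.exists_output emit hemit h
    refine ⟨v, t, y, h, hy, ?_⟩
    have hf := M.reach_final emit h hy
    have hfs : (M.simulation emit).program.toInputTM.step w
        ((M.simulation emit).program.toInputTM.final v y) = none := by
      cases v <;> rfl
    have e1 := mem_eval.2 ⟨hc, hs⟩
    have e2 := mem_eval.2 ⟨hf, hfs⟩
    -- A deterministic computation stops in at most one configuration.
    exact Part.mem_unique e1 e2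
  · push Not at h
    exact (M.step_ne_none_of_not_halting emit h hc hs).elim

theorem hasWord_ofWord_iff {α : Type u} (y y' : List α) : (ofWord y).HasWord y' ↔ y' = y := by
  have h : IsInitialWord (fun n : ℕ => (ofWord y).cells ((ofWord y).head + n)) y := by
    intro n _
    simp [ofWord]
  constructor
  · intro h'
    exact IsInitialWord.unique h' h
  · rintro rfl
    exact h

theorem yields_simulation_iff (hemit : emit none = none) (w : List A) (v : Bool) (y : List Γ) :
    (M.simulation emit).program.toInputTM.Yields w v y ↔
      ∃ t, Reaches M.step (M.init w) (M.haltState v, t) ∧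
        IsInitialWord (fun n : ℕ => emit (t.cells (t.head + n))) y := by
  constructor
  · rintro ⟨c, hc, hv, hy⟩
    have hs : (M.simulation emit).program.toInputTM.step w c = none := by
      unfold InputTM.step
      rw [hv]
      cases v <;> rfl
    obtain ⟨v', t, y', h, hy', rfl⟩ := M.eq_final_of_halting emit hemit hc hs
    obtain rfl : y = y' := (hasWord_ofWord_iff _ _).1 hy
    obtain rfl : v' = v := by
      cases v <;> cases v' <;> first | rfl | cases hv
    exact ⟨t, h, hy'⟩
  · rintro ⟨t, h, hy⟩
    exact ⟨_, M.reach_final emit h hy, rfl, (hasWord_ofWord_iff _ _).2 rfl⟩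

theorem zeroThermodynamicCost_simulation (hemit : emit none = none) :
    (M.simulation emit).program.toInputTM.ZeroThermodynamicCost := by
  refine ⟨Program.reversible _, fun w c hc hs => ?_⟩
  obtain ⟨v, -, y, -, -, h⟩ := M.eq_final_of_halting emit hemit hc hs
  exact ⟨v, y, h⟩

end OneTapeTM

end ReadTwice

theorem theorem1 {A Γ Q : Type u} [Finite A] [Finite Γ] [Finite Q]
    (M : ReadTwice.OneTapeTM A Γ Q) :
    (∃ R : ReadTwice.InputTM A Γ,
      R.TwoPass ∧ R.ComputesSame M ∧ R.ZeroThermodynamicCost) ∧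
    (∃ R : ReadTwice.InputTM A Γ,
      R.TwoPass ∧ R.DecidesSame M ∧ R.ZeroThermodynamicCost) := by
  -- With `emit = id` the initial word emitted is the output of `M` by definition. The constant
  -- `none` copies nothing, which gives the deciding machine.
  refine ⟨⟨(M.simulation id).program.toInputTM, ReadTwice.Simulation.twoPass _,
    M.yields_simulation_iff id rfl, M.zeroThermodynamicCost_simulation id rfl⟩,
    ⟨(M.simulation fun _ => none).program.toInputTM, ReadTwice.Simulation.twoPass _,
      fun w v y => (M.yields_simulation_iff _ rfl w v y).trans ?_,
      M.zeroThermodynamicCost_simulation _ rfl⟩⟩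
  constructor
  · rintro ⟨t, h, hy⟩
    exact ⟨by simpa using hy 0 (Nat.zero_le _), t, h⟩
  · rintro ⟨rfl, t, h⟩
    exact ⟨t, h, fun n _ => by simp⟩
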